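/- Let $J$ be a (tame) knot in $S^3$, let $\nu(J)$ be the interior of a tubular neighborhood of $J$, let $M_J = S^3 - \nu(J)$ be the knot exterior, and let $G$ be the commutator subgroup of the knot group $\pi_1(M_J)$. Let $\Delta_J(t)\in\mathbb{Z}[t,t^{-1}]$ be the Alexander polynomial of $J$, i.e. a generator of the order ideal (zeroth Fitting ideal) of the $\mathbb{Z}[t,t^{-1}]$-module $G/[G,G]$, on which $t$ acts as conjugation by an element of $\pi_1(M_J)$ representing a generator of $\pi_1(M_J)^{\mathrm{ab}}\cong\mathbb{Z}$; it is defined up to multiplication by units $\pm t^k$. Suppose that $\Delta_J$ is trivial, i.e. $\Delta_J = 1$ up to units. Then $G$ is perfect, $G=[G,G]$; for every proper normal subgroup $N$ of $G$ the quotient $G/N$ is not nilpotent; and, if $G$ is nontrivial (that is, if $J$ is not the unknot), $G$ is not residually torsion-free nilpotent. Here a group $\Gamma$ is residually torsion-free nilpotent if for every nontrivial $x\in\Gamma$ there is a normal subgroup $N$ of $\Gamma$ with $x\notin N$ such that $\Gamma/N$ is torsion-free and nilpotent. -/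

import Mathlib

open scoped LaurentPolynomial

/-! ## Knots in the three-sphere, knot exteriors and knot groups -/

/-- The three-sphere, as the unit sphere of `ℝ⁴`. -/
abbrev ThreeSphere : Type := Metric.sphere (0 : EuclideanSpace ℝ (Fin 4)) 1

/-- A tubular neighborhood of a closed curve `f` in the three-sphere, in coordinates: an open
embedding of `S¹ × ℝ²` whose core `S¹ × 0` is `f`. The images of `S¹ × {‖v‖ ≤ 1}` and
`S¹ × {‖v‖ < 1}` are the closed tubular neighborhood and its interior. -/
structure TubularNeighborhood (f : Circle → ThreeSphere) where
  toFun : Circle × EuclideanSpace ℝ (Fin 2) → ThreeSphere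
  isOpenEmbedding : Topology.IsOpenEmbedding toFun
  core : ∀ z : Circle, toFun (z, 0) = f z

/-- A (tame) knot in the three-sphere: an embedded circle which has a tubular neighborhood.
All smooth and all piecewise linear knots are of this kind. -/
structure Knot where
  toFun : Circle → ThreeSphere
  isEmbedding : Topology.IsEmbedding toFun
  tame : Nonempty (TubularNeighborhood toFun)

namespace Knot

/-- The interior `ν(J)` of the tubular neighborhood: the image of `S¹ × {‖v‖ < 1}`. -/
def openTube (J : Knot) (ν : TubularNeighborhood J.toFun) : Set ThreeSphere :=
  ν.toFun '' {p | ‖p.2‖ < 1}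

/-- The knot exterior `M_J = S³ - ν(J)`. -/
abbrev Exterior (J : Knot) (ν : TubularNeighborhood J.toFun) : Type :=
  ((J.openTube ν)ᶜ : Set ThreeSphere)

/-- The knot group `π₁(M_J)` with base point `x`. -/
abbrev group (J : Knot) (ν : TubularNeighborhood J.toFun) (x : J.Exterior ν) : Type :=
  FundamentalGroup (J.Exterior ν) x

end Knot

/-! ## The Alexander module and the Alexander polynomial -/

/-- The order ideal (zeroth elementary ideal, or zeroth Fitting ideal) of a finitely generated
module `M`: the ideal generated by the determinants of all square matrices whose rows are
relations between the members of a finite generating family of `M`. (For each one generating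
family these determinants already generate the same ideal, that of the maximal minors of a
presentation matrix.) -/
def orderIdeal (R : Type*) [CommRing R] (M : Type*) [AddCommGroup M] [Module R M] : Ideal R :=
  Ideal.span {d : R | ∃ (n : ℕ) (m : Fin n → M) (A : Matrix (Fin n) (Fin n) R),
    Submodule.span R (Set.range m) = ⊤ ∧ (∀ i, ∑ j, A i j • m j = 0) ∧ d = A.det}

section AlexanderModule

variable {π : Type*} [Group π]

/-- The abelianization `G / [G, G]` of the commutator subgroup `G` of `π`, written additively.
For a knot group this is the first homology group of the infinite cyclic cover of the exterior.
It depends on `t` only through its module structure, defined below. -/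
def AlexanderModule (_t : π) : Type _ := Additive (Abelianization (commutator π))

noncomputable instance (t : π) : AddCommGroup (AlexanderModule t) :=
  inferInstanceAs (AddCommGroup (Additive (Abelianization (commutator π))))

/-- The class in `G / [G, G]` of an element of the commutator subgroup `G` of `π`. -/
def AlexanderModule.of (t : π) (g : commutator π) : AlexanderModule t :=
  Additive.ofMul (Abelianization.of g)

/-- The automorphism of `G / [G, G]` induced by the conjugation `g ↦ t g t⁻¹` of `G`. -/
noncomputable def AlexanderModule.conj (t : π) : AlexanderModule t ≃+ AlexanderModule t :=
  MulEquiv.toAdditive (MulAut.conjNormal (H := commutator π) t).abelianizationCongr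

/-- The same automorphism, as a unit of the ring of additive endomorphisms. -/
noncomputable def AlexanderModule.conjUnit (t : π) : (AddMonoid.End (AlexanderModule t))ˣ where
  val := (AlexanderModule.conj t).toAddMonoidHom
  inv := (AlexanderModule.conj t).symm.toAddMonoidHom
  val_inv := by ext a; exact (AlexanderModule.conj t).apply_symm_apply a
  inv_val := by ext a; exact (AlexanderModule.conj t).symm_apply_apply a

/-- The action of the Laurent polynomials on `G / [G, G]`, in which `T ^ n` acts as the `n`-th
power of the conjugation by `t`. -/
noncomputable def AlexanderModule.action (t : π) :
    ℤ[T;T⁻¹] →+* AddMonoid.End (AlexanderModule t) :=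
  (AddMonoidAlgebra.lift ℤ (AddMonoid.End (AlexanderModule t)) ℤ
    ((Units.coeHom _).comp (zpowersHom _ (AlexanderModule.conjUnit t)))).toRingHom

noncomputable instance (t : π) : Module ℤ[T;T⁻¹] (AlexanderModule t) :=
  Module.compHom (AlexanderModule t) (AlexanderModule.action t)

/-- The variable acts by conjugation by `t`. -/
theorem AlexanderModule.T_smul_of (t : π) (g : commutator π) :
    (LaurentPolynomial.T 1 : ℤ[T;T⁻¹]) • AlexanderModule.of t g =
      AlexanderModule.of t (MulAut.conjNormal t g) := by
  change AlexanderModule.action t (LaurentPolynomial.T 1) (AlexanderModule.of t g) = _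
  have : AlexanderModule.action t (LaurentPolynomial.T 1) =
      (AlexanderModule.conjUnit t : AddMonoid.End (AlexanderModule t)) := by
    refine (AddMonoidAlgebra.lift_single _ _ _).trans ?_
    simp
  rw [this]
  rfl

/-- `t` represents a generator of the abelianization of `π`, and this is infinite cyclic. -/
def IsInfiniteCyclicGenerator (t : π) : Prop :=
  (∀ g : π, ∃ n : ℤ, Abelianization.of g = Abelianization.of t ^ n) ∧
    ∀ n : ℤ, Abelianization.of t ^ n = 1 → n = 0

end AlexanderModule

/-- `Δ` is an Alexander polynomial of the group `π`: the abelianization of `π` is infinite cyclic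
and, for an element `t` of `π` which represents a generator of it, `Δ` generates the order ideal
of the Alexander module. -/
def IsAlexanderPolynomial (π : Type*) [Group π] (Δ : ℤ[T;T⁻¹]) : Prop :=
  ∃ t : π, IsInfiniteCyclicGenerator t ∧
    orderIdeal ℤ[T;T⁻¹] (AlexanderModule t) = Ideal.span {Δ}

/-- `Δ` is an Alexander polynomial of the knot `J`; it is determined up to units `± T ^ n` (and the
substitution of `T⁻¹` for `T`, under which Alexander polynomials of knots are symmetric). -/
def Knot.IsAlexanderPolynomial (J : Knot) (ν : TubularNeighborhood J.toFun) (x : J.Exterior ν)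
    (Δ : ℤ[T;T⁻¹]) : Prop :=
  _root_.IsAlexanderPolynomial (J.group ν x) Δ

/-! ## Residual torsion-free nilpotence -/

/-- `Γ` is residually torsion-free nilpotent: every nontrivial element lies outside some normal
subgroup whose quotient is nilpotent and has no nontrivial element of finite order. -/
def IsResiduallyTorsionFreeNilpotent (Γ : Type*) [Group Γ] : Prop :=
  ∀ x : Γ, x ≠ 1 → ∃ (N : Subgroup Γ) (_ : N.Normal), x ∉ N ∧
    (∀ y : Γ ⧸ N, IsOfFinOrder y → y = 1) ∧ Group.IsNilpotent (Γ ⧸ N)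

/-! The argument is purely algebraic. By Cramer's rule the order ideal kills the Alexander module;
if `Δ` is a unit, that ideal contains 1, so G/[G,G] = 0 and G is perfect. Perfectness passes to
quotients, and the lower central series of a perfect group never descends, so the only nilpotent
quotient of G is the trivial one. Hence no nontrivial element of G can be separated from 1 in a
nilpotent quotient. -/

/-- Cramer's rule: the order ideal of a module annihilates it. -/
theorem orderIdeal_le_annihilator (R : Type*) [CommRing R] (M : Type*) [AddCommGroup M]
    [Module R M] : orderIdeal R M ≤ Module.annihilator R M := by
  refine Ideal.span_le.2 ?_
  rintro d ⟨n, m, A, hm, hA, rfl⟩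
  have key : ∀ i, A.det • m i = 0 := by
    intro i
    -- Apply row `i` of the adjugate to the relations `A m = 0`; exchanging the sums then exposes
    -- `adjugate A * A = det A • 1`.
    have h : ∑ k, A.adjugate i k • ∑ j, A k j • m j = 0 := by simp [hA]
    simp only [Finset.smul_sum, smul_smul] at h
    rw [Finset.sum_comm] at h
    simp only [← Finset.sum_smul, ← Matrix.mul_apply, Matrix.adjugate_mul, Matrix.smul_apply,
      Matrix.one_apply, smul_eq_mul, mul_ite, mul_one, mul_zero, ite_smul, zero_smul,
      Finset.sum_ite_eq, Finset.mem_univ, if_true] at h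
    exact h
  refine Module.mem_annihilator.2 fun x => ?_
  have hx : x ∈ Submodule.span R (Set.range m) := hm ▸ Submodule.mem_top
  induction hx using Submodule.span_induction with
  | mem x hx => obtain ⟨i, rfl⟩ := hx; exact key i
  | zero => exact smul_zero _
  | add x y _ _ hx hy => rw [smul_add, hx, hy, add_zero]
  | smul a x _ hx => rw [smul_comm, hx, smul_zero]

/-- If the Alexander polynomial is a unit then the commutator subgroup is perfect. -/
theorem IsAlexanderPolynomial.commutator_commutator_eq_top {π : Type*} [Group π] {Δ : ℤ[T;T⁻¹]}
    (h : IsAlexanderPolynomial π Δ) (hΔ : IsUnit Δ) : commutator (commutator π) = ⊤ := by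
  obtain ⟨t, -, ht⟩ := h
  rw [Ideal.span_singleton_eq_top.2 hΔ] at ht
  have hann : (1 : ℤ[T;T⁻¹]) ∈ Module.annihilator ℤ[T;T⁻¹] (AlexanderModule t) :=
    orderIdeal_le_annihilator _ _ (ht ▸ Submodule.mem_top)
  refine eq_top_iff.2 fun g _ => ?_
  have hg : AlexanderModule.of t g = 0 := by
    simpa using Module.mem_annihilator.1 hann (AlexanderModule.of t g)
  -- The abelianization is the quotient by the commutator subgroup, so a vanishing class means
  -- membership in it.
  exact (QuotientGroup.eq_one_iff g).1 (Additive.ofMul.injective hg)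

/-- A perfect nilpotent group is trivial. -/
theorem subsingleton_of_commutator_eq_top_of_isNilpotent {G : Type*} [Group G]
    (h : commutator G = ⊤) (hG : Group.IsNilpotent G) : Subsingleton G := by
  obtain ⟨n, hn⟩ := Subgroup.nilpotent_iff_lowerCentralSeries.1 hG
  have htop : ∀ k, Subgroup.lowerCentralSeries (⊤ : Subgroup G) k = ⊤ := by
    intro k
    induction k with
    | zero => rfl
    | succ k ih => rw [Subgroup.lowerCentralSeries_succ, ih]; exact h
  exact Subgroup.subsingleton_iff.1 (subsingleton_of_bot_eq_top (hn.symm.trans (htop n)))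

/-- A nilpotent quotient of a perfect group is trivial. -/
theorem eq_top_of_commutator_eq_top_of_isNilpotent_quotient {G : Type*} [Group G]
    (h : commutator G = ⊤) (N : Subgroup G) [N.Normal] (hN : Group.IsNilpotent (G ⧸ N)) :
    N = ⊤ := by
  have hq : commutator (G ⧸ N) = ⊤ := by
    have hs := QuotientGroup.mk'_surjective N
    -- A surjection carries the commutator subgroup onto that of its target.
    have := Subgroup.map_commutator (⊤ : Subgroup G) ⊤ (QuotientGroup.mk' N)
    rw [← commutator_def, h, Subgroup.map_top_of_surjective _ hs] at this
    exact this.symm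
  exact QuotientGroup.subgroup_eq_top_of_subsingleton N
    (subsingleton_of_commutator_eq_top_of_isNilpotent hq hN)

theorem mainTheorem9 (J : Knot) (ν : TubularNeighborhood J.toFun) (x : J.Exterior ν)
    (Δ : ℤ[T;T⁻¹]) (hΔ : J.IsAlexanderPolynomial ν x Δ) (htriv : Associated Δ 1) :
    commutator (commutator (J.group ν x)) = ⊤ ∧
    (∀ (N : Subgroup (commutator (J.group ν x))) [N.Normal], N ≠ ⊤ →
      ¬ Group.IsNilpotent (commutator (J.group ν x) ⧸ N)) ∧
    (Nontrivial (commutator (J.group ν x)) →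
      ¬ IsResiduallyTorsionFreeNilpotent (commutator (J.group ν x))) := by
  have hperf := IsAlexanderPolynomial.commutator_commutator_eq_top hΔ (associated_one_iff_isUnit.1 htriv)
  refine ⟨hperf, fun N _ hN hnil =>
    hN (eq_top_of_commutator_eq_top_of_isNilpotent_quotient hperf N hnil), fun _ hres => ?_⟩
  -- Any `g ≠ 1` serves: the `N` that should avoid it is all of G.
  obtain ⟨g, hg⟩ := exists_ne (1 : commutator (J.group ν x))
  obtain ⟨N, _, hgN, -, hnil⟩ := hres g hg
  exact hgN (eq_top_of_commutator_eq_top_of_isNilpotent_quotient hperf N hnil ▸ Subgroup.mem_top g)
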